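/- Let $X$ be a separable real Banach space. A *tree on $X$* is a non-empty set $T\subseteq\bigcup_{n\ge1}X^n$ of finite sequences, ordered by extension: $(x_1,\dots,x_m)\le(y_1,\dots,y_n)$ iff $m\le n$ and $x_i=y_i$ for $i\le m$. For such a set $T$ let $D(T)$ be the set of non-maximal elements of $T$, and put $T^0=T$, $T^{\alpha+1}=D(T^\alpha)$, and $T^\alpha=\bigcap_{\beta<\alpha}T^\beta$ for limit $\alpha$. The *order* $o(T)$ is the least $\alpha$ with $T^\alpha=\emptyset$ if there is a countable such $\alpha$, and $o(T)=\omega_1$ otherwise. A finite sequence $(x_i)_1^m$ is *normalized* if $\|x_i\|=1$ for all $i$, and *$K$-basic* if $\|\sum_{i\le k}a_ix_i\|\le K\|\sum_{i\le m}a_ix_i\|$ for all real $a_1,\dots,a_m$ and all $k\le m$. We write $[x_i]_1^m$ for the linear span. For each real $K\ge1$ let $P(K)$ be a set of finite sequences of length at least $1$ in $X$, such that $P(K)\subseteq P(L)$ whenever $1\le K\le L$, and such that for every $n$ some $P(K)$ contains a sequence of length at least $n$. Put $$I_P(X)=\sup_{K\ge1}\ \sup\{o(T): T\text{ is a tree on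 }X\text{ with }T\subseteq P(K)\}.$$ Assume: 1. For every $K\ge1$, every $(x_i)_1^m\in P(K)$ is normalized and $K$-basic. 2. For all $K,L,C\ge1$ there is $K'=K'(K,L,C)\ge1$ such that if $(x_i)_1^m\in P(K)$, $(y_j)_1^n\in P(L)$ and $\max(\|x\|,\|y\|)\le C\|x+y\|$ for all $x\in[x_i]_1^m$, $y\in[y_j]_1^n$, then $(x_1,\dots,x_m,y_1,\dots,y_n)\in P(K')$. 3. For every $K\ge1$ there is $L=L(K)\ge1$ such that $(x_i)_k^l\in P(L)$ for every $(x_i)_1^m\in P(K)$ and all $1\le k\le l\le m$. 4. For every $K\ge1$ there is $K''=K''(K)\ge1$ such that for every $n\ge1$ the closure of $X^n\cap P(K)$ in the product topology of $X^n$ is contained in $X^n\cap P(K'')$. Then either $I_P(X)=\omega_1$ and there exist a sequence $(x_i)_{i=1}^\infty$ of unit vectors of $X$ and $K\ge1$ such that $(x_i)_1^m\in P(K)$ for every $m\ge1$, or else $I_P(X)=\omega^\alpha$ for some ordinal $\alpha<\omega_1$. -/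

import Mathlib

open scoped Ordinal

namespace BanachTree

universe u

/-- A tree on a set `X`: a non-empty set of non-empty finite sequences of elements of `X`,
ordered by `s ≤ t` iff `s` is an initial segment of `t` (that is, `s <+: t`). -/
def IsTreeOn {X : Type u} (T : Set (List X)) : Prop :=
  T.Nonempty ∧ ([] : List X) ∉ T

/-- The derived tree `D(T)`: the nodes of `T` which have a strictly larger node in `T`. -/
def derived {X : Type u} (T : Set (List X)) : Set (List X) :=
  {s | s ∈ T ∧ ∃ t ∈ T, s <+: t ∧ s ≠ t}

/-- The iterated derived trees: `T⁰ = T`, `T^(α+1) = D(T^α)`, and `T^α = ⋂_{β<α} T^β` for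
limit `α`. -/
noncomputable def iterDerived {X : Type u} (T : Set (List X)) (α : Ordinal.{0}) :
    Set (List X) :=
  Ordinal.limitRecOn α T (fun _ S => derived S) (fun α _ S => ⋂ β, ⋂ h : β < α, S β h)

theorem iterDerived_zero {X : Type u} (T : Set (List X)) : iterDerived T 0 = T := by
  simp [iterDerived]

theorem iterDerived_succ {X : Type u} (T : Set (List X)) (α : Ordinal.{0}) :
    iterDerived T (Order.succ α) = derived (iterDerived T α) := by
  simp [iterDerived]

theorem iterDerived_limit {X : Type u} (T : Set (List X)) {α : Ordinal.{0}}
    (h : Order.IsSuccLimit α) :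
    iterDerived T α = ⋂ β, ⋂ _ : β < α, iterDerived T β := by
  simp only [iterDerived]
  rw [Ordinal.limitRecOn_limit _ _ _ _ h]

open Classical in
/-- The order `o(T)`: the least `α` with `T^α = ∅` if there is a countable such `α`, and `ω₁`
otherwise. -/
noncomputable def order {X : Type u} (T : Set (List X)) : Ordinal.{0} :=
  if ∃ α < ω₁, iterDerived T α = ∅ then sInf {α | iterDerived T α = ∅} else ω₁

theorem order_le {X : Type u} (T : Set (List X)) : order T ≤ ω₁ := by
  unfold order
  split_ifs with h
  · obtain ⟨α, hα, h⟩ := h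
    exact (csInf_le' (show α ∈ {α | iterDerived T α = ∅} from h)).trans hα.le
  · exact le_rfl

/-- The `P(K)` index of `X`: the supremum of the orders of the trees on `X` all of whose nodes
belong to `P K`. The supremum is over a set of ordinals bounded by `ω₁`. -/
noncomputable def indexAt {X : Type u} (P : ℝ → Set (List X)) (K : ℝ) : Ordinal.{0} :=
  sSup {o | ∃ T : Set (List X), IsTreeOn T ∧ (∀ s ∈ T, s ∈ P K) ∧ o = order T}

/-- The `P` index of `X`, the supremum of the `P(K)` indices over all real `K ≥ 1`. -/
noncomputable def index {X : Type u} (P : ℝ → Set (List X)) : Ordinal.{0} :=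
  sSup (indexAt P '' Set.Ici 1)

theorem bddAbove_indexAt {X : Type u} (P : ℝ → Set (List X)) (K : ℝ) :
    BddAbove {o | ∃ T : Set (List X), IsTreeOn T ∧ (∀ s ∈ T, s ∈ P K) ∧ o = order T} := by
  refine ⟨ω₁, ?_⟩
  rintro _ ⟨T, _, _, rfl⟩
  exact order_le T

theorem bddAbove_index {X : Type u} (P : ℝ → Set (List X)) :
    BddAbove (indexAt P '' Set.Ici 1) := by
  refine ⟨ω₁, ?_⟩
  rintro _ ⟨K, _, rfl⟩
  apply csSup_le'
  rintro _ ⟨T, _, _, rfl⟩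
  exact order_le T

/-- The finite sequence consists of vectors of norm one. -/
def IsNormalized {X : Type u} [NormedAddCommGroup X] (s : List X) : Prop :=
  ∀ x ∈ s, ‖x‖ = 1

/-- The finite sequence `x₁, …, xₘ` satisfies
`‖∑_{i ≤ k} aᵢ xᵢ‖ ≤ K ‖∑_{i ≤ m} aᵢ xᵢ‖` for all real scalars and all `k`. For sequences of
nonzero vectors this says that the sequence is basic with basis constant at most `K`. -/
def IsBasicWith {X : Type u} [NormedAddCommGroup X] [NormedSpace ℝ X] (K : ℝ) (s : List X) :
    Prop :=
  ∀ (a : Fin s.length → ℝ) (k : ℕ),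
    ‖∑ i with i.val < k, a i • s.get i‖ ≤ K * ‖∑ i, a i • s.get i‖

/-- The linear span `[x₁, …, xₘ]` of a finite sequence (it is automatically closed). -/
def seqSpan {X : Type u} [NormedAddCommGroup X] [NormedSpace ℝ X] (s : List X) :
    Submodule ℝ X :=
  Submodule.span ℝ {x | x ∈ s}

/-- `max (‖x‖, ‖y‖) ≤ C ‖x + y‖` for all `x` in the span of `s` and `y` in the span of `t`. -/
def IsSeparated {X : Type u} [NormedAddCommGroup X] [NormedSpace ℝ X] (C : ℝ)
    (s t : List X) : Prop :=
  ∀ x ∈ seqSpan s, ∀ y ∈ seqSpan t, max ‖x‖ ‖y‖ ≤ C * ‖x + y‖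

end BanachTree

namespace BanachTree

universe u v

/-! ### Derived trees as an ordinal rank on nodes -/

section Derived

variable {X : Type u} {Y : Type v}

/-! If the index is `ω₁`, one `P K` has all its countable derivatives non-empty. A countable-basis
stabilisation argument then builds an infinite branch in the closure of its prefix tree
(`exists_branch_closure`), and the segment and closure hypotheses absorb this into a larger
constant. If the index is countable, it lies in `[ω ^ α, ω ^ (α + 1))`. Were it greater than `ω ^
α`, some `P K` would have rank above `ω ^ α`, and gluing would give rank `ω ^ α * (n + 1)` for every
`n` (`exists_rank_mul_nat`), a contradiction. Gluing attaches to each node a tree of tails separated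
from it (`exists_separated_tails`). Such tails exist by compactness and pigeonhole: the unit sphere
of the node's span has a finite net, and along one `K`-basic branch two successive blocks cannot
both have spans close to the same unit vector. Rank `β` times a finite number thus leaves rank `β`
away from the whole net, a loss that `ω ^ α` tolerates. -/

theorem mem_iterDerived_iff (T : Set (List X)) (α : Ordinal.{0}) (s : List X) :
    s ∈ iterDerived T α ↔
      s ∈ T ∧ ∀ β < α, ∃ t ∈ iterDerived T β, s <+: t ∧ s ≠ t := by
  induction α using Ordinal.limitRecOn generalizing s with
  | zero => simp [iterDerived_zero]
  | add_one α ih =>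
    rw [← Order.succ_eq_add_one, iterDerived_succ]
    constructor
    · rintro ⟨hs, t, ht, h⟩
      refine ⟨((ih s).1 hs).1, fun β hβ => ?_⟩
      rcases (Order.lt_succ_iff.1 hβ).eq_or_lt with rfl | hβ
      · exact ⟨t, ht, h⟩
      · exact ((ih s).1 hs).2 β hβ
    · rintro ⟨hs, h⟩
      exact ⟨(ih s).2 ⟨hs, fun β hβ => h β (hβ.trans (Order.lt_succ α))⟩,
        h α (Order.lt_succ α)⟩
  | limit α hα ih =>
    rw [iterDerived_limit _ hα]
    simp only [Set.mem_iInter]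
    constructor
    · intro h
      refine ⟨((ih 0 hα.bot_lt s).1 (h 0 hα.bot_lt)).1, fun β hβ => ?_⟩
      have := h (Order.succ β) (hα.succ_lt hβ)
      rw [iterDerived_succ] at this
      exact this.2
    · rintro ⟨hs, h⟩ β hβ
      exact (ih β hβ s).2 ⟨hs, fun γ hγ => h γ (hγ.trans hβ)⟩

theorem iterDerived_subset (T : Set (List X)) (α : Ordinal.{0}) : iterDerived T α ⊆ T :=
  fun s hs => ((mem_iterDerived_iff T α s).1 hs).1

theorem iterDerived_antitone (T : Set (List X)) : Antitone (iterDerived T) := by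
  intro α β h s hs
  rw [mem_iterDerived_iff] at hs ⊢
  exact ⟨hs.1, fun γ hγ => hs.2 γ (hγ.trans_le h)⟩

/-- Maps between trees that preserve strict extension do not decrease ranks. -/
theorem map_mem_iterDerived {T : Set (List X)} {T' : Set (List Y)} (f : List X → List Y)
    (hf : ∀ s ∈ T, f s ∈ T')
    (hlt : ∀ s ∈ T, ∀ t ∈ T, s <+: t → s ≠ t → f s <+: f t ∧ f s ≠ f t)
    (α : Ordinal.{0}) {s : List X} (hs : s ∈ iterDerived T α) :
    f s ∈ iterDerived T' α := by
  induction α using WellFoundedLT.induction generalizing s with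
  | ind α ih =>
    rw [mem_iterDerived_iff] at hs ⊢
    refine ⟨hf s hs.1, fun β hβ => ?_⟩
    obtain ⟨t, ht, h1, h2⟩ := hs.2 β hβ
    exact ⟨f t, ih β hβ ht, hlt s hs.1 t (iterDerived_subset T β ht) h1 h2⟩

theorem iterDerived_mono {T T' : Set (List X)} (h : T ⊆ T') (α : Ordinal.{0}) :
    iterDerived T α ⊆ iterDerived T' α :=
  fun _ hs => map_mem_iterDerived id h (fun _ _ _ _ h1 h2 => ⟨h1, h2⟩) α hs

theorem mem_iterDerived_of_prefix {T : Set (List X)} {α : Ordinal.{0}} {s t : List X}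
    (hs : s ∈ T) (ht : t ∈ iterDerived T α) (h : s <+: t) : s ∈ iterDerived T α := by
  rw [mem_iterDerived_iff] at ht ⊢
  refine ⟨hs, fun β hβ => ?_⟩
  obtain ⟨r, hr, h1, h2⟩ := ht.2 β hβ
  refine ⟨r, hr, h.trans h1, ?_⟩
  rintro rfl
  exact h2 (h1.eq_of_length (le_antisymm h1.length_le h.length_le))

theorem append_strict {s u v : List X} (h : u <+: v) (hne : u ≠ v) :
    s ++ u <+: s ++ v ∧ s ++ u ≠ s ++ v :=
  ⟨(List.prefix_append_right_inj s).2 h, fun h' => hne (List.append_cancel_left h')⟩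

/-- Attaching to each node `s` of `S` a tree of rank at least `δ` raises the rank by `δ` on the
left. -/
theorem mem_iterDerived_attach {S : Set (List X)} {U : List X → Set (List X)}
    {δ : Ordinal.{0}} (hU : ∀ s ∈ S, ∀ γ < δ, (iterDerived (U s) γ).Nonempty)
    (hU0 : ∀ s ∈ S, [] ∉ U s) (γ : Ordinal.{0}) {s : List X} (hs : s ∈ iterDerived S γ) :
    s ∈ iterDerived (S ∪ {t | ∃ s ∈ S, ∃ u ∈ U s, t = s ++ u}) (δ + γ) := by
  induction γ using WellFoundedLT.induction generalizing s with
  | ind γ ih =>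
    have hsS := iterDerived_subset S γ hs
    rw [mem_iterDerived_iff]
    refine ⟨Or.inl hsS, fun ε hε => ?_⟩
    rcases lt_or_ge ε δ with h | h
    · obtain ⟨u, hu⟩ := hU s hsS ε h
      refine ⟨s ++ u, map_mem_iterDerived (s ++ ·) (fun u hu => Or.inr ⟨s, hsS, u, hu, rfl⟩)
        (fun _ _ _ _ h1 h2 => append_strict h1 h2) ε hu, List.prefix_append s u, fun h' => ?_⟩
      have : u = [] := by simpa using h'
      exact hU0 s hsS (this ▸ iterDerived_subset _ ε hu)
    · have hlt : ε - δ < γ := by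
        rw [← add_lt_add_iff_left δ, Ordinal.add_sub_cancel_of_le h]
        exact hε
      obtain ⟨t, ht, h1⟩ := ((mem_iterDerived_iff S γ s).1 hs).2 _ hlt
      refine ⟨t, ?_, h1⟩
      have := ih _ hlt ht
      rwa [Ordinal.add_sub_cancel_of_le h] at this

/-- If all proper extensions `s ++ u` of `s` of rank at least `δ` have `u ∈ G`, and `s` has rank
at least `δ + β`, then `G` has rank at least `β`. -/
theorem iterDerived_tail_nonempty {T G : Set (List X)} {s : List X} {δ β : Ordinal.{0}}
    (hG : ∀ u ≠ [], s ++ u ∈ iterDerived T δ → u ∈ G) (hs : s ∈ iterDerived T (δ + β)) :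
    ∀ γ < β, (iterDerived G γ).Nonempty := by
  have key : ∀ γ : Ordinal.{0}, ∀ u ≠ [], s ++ u ∈ iterDerived T (δ + γ) →
      u ∈ iterDerived G γ := by
    intro γ
    induction γ using WellFoundedLT.induction with
    | ind γ ih =>
      intro u hu h
      rw [mem_iterDerived_iff]
      refine ⟨hG u hu (iterDerived_antitone T le_self_add h), fun ε hε => ?_⟩
      obtain ⟨t, ht, ⟨r, rfl⟩, hne⟩ :=
        ((mem_iterDerived_iff T _ _).1 h).2 (δ + ε) (by simpa using hε)
      rw [List.append_assoc] at ht
      refine ⟨u ++ r, ih ε hε _ (by simp [hu]) ht, List.prefix_append u r, ?_⟩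
      intro h'
      apply hne
      rw [List.append_assoc, ← h']
  intro γ hγ
  obtain ⟨t, ht, ⟨r, rfl⟩, hne⟩ :=
    ((mem_iterDerived_iff T _ _).1 hs).2 (δ + γ) (by simpa using hγ)
  exact ⟨r, key γ r (by rintro rfl; simp at hne) ht⟩

theorem iterDerived_prefixes_nonempty {T : Set (List X)} {s : List X}
    (hT : ∀ t ≠ [], t <+: s → t ∈ T) (n : ℕ) (hn : n < s.length) :
    (iterDerived T n).Nonempty := by
  have key : ∀ n : ℕ, ∀ t ≠ [], t <+: s → t.length + n ≤ s.length → t ∈ iterDerived T n := by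
    intro n
    induction n with
    | zero => intro t h1 h2 _; simpa [iterDerived_zero] using hT t h1 h2
    | succ n ih =>
      intro t h1 h2 h3
      rw [Nat.cast_succ, ← Order.succ_eq_add_one, iterDerived_succ]
      have hp : t <+: s.take (t.length + 1) :=
        List.prefix_take_iff.2 ⟨h2, by omega⟩
      have hl : (s.take (t.length + 1)).length = t.length + 1 := by
        simp; omega
      have hq := List.take_prefix (t.length + 1) s
      refine ⟨ih t h1 h2 (by omega), s.take (t.length + 1), ih _ ?_ hq (by omega), hp, ?_⟩
      · intro h; simp [h] at hl
      · intro h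
        have := congrArg List.length h
        omega
  refine ⟨s.take (s.length - n), key n _ ?_ (List.take_prefix _ s) (by simp; omega)⟩
  intro h
  have := congrArg List.length h
  simp at this
  omega

end Derived

/-! ### The index in terms of the derivatives of `P K` -/

section Index

variable {X : Type u} {P : ℝ → Set (List X)}

theorem iterDerived_nonempty_of_lt_order {T : Set (List X)} {β : Ordinal.{0}}
    (h : β < order T) : (iterDerived T β).Nonempty := by
  rw [Set.nonempty_iff_ne_empty]
  intro h0
  have hβ : β < ω₁ := h.trans_le (order_le T)
  have : order T = sInf {α | iterDerived T α = ∅} := if_pos ⟨β, hβ, h0⟩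
  rw [this] at h
  exact (csInf_le' (show β ∈ {α | iterDerived T α = ∅} from h0)).not_gt h

theorem le_order {T : Set (List X)} {δ : Ordinal.{0}} (hδ : δ ≤ ω₁)
    (h : ∀ γ < δ, (iterDerived T γ).Nonempty) : δ ≤ order T := by
  unfold order
  split_ifs with h'
  · obtain ⟨α, -, hα⟩ := h'
    refine le_csInf ⟨α, hα⟩ fun β hβ => ?_
    by_contra hlt
    exact (h β (not_le.1 hlt)).ne_empty hβ
  · exact hδ

theorem index_le (P : ℝ → Set (List X)) : index P ≤ ω₁ := by
  apply csSup_le'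
  rintro _ ⟨K, _, rfl⟩
  apply csSup_le'
  rintro _ ⟨T, _, _, rfl⟩
  exact order_le T

/-- Derivation is monotone in the tree, so `P K` itself serves as the extremal tree. -/
theorem exists_iterDerived_nonempty_of_lt_index {β : Ordinal.{0}} (h : β < index P) :
    ∃ K : ℝ, 1 ≤ K ∧ (iterDerived (P K) β).Nonempty := by
  obtain ⟨_, ⟨K, hK, rfl⟩, h⟩ := (lt_csSup_iff' (bddAbove_index P)).1 h
  obtain ⟨_, ⟨T, -, hT, rfl⟩, h⟩ := (lt_csSup_iff' (bddAbove_indexAt P K)).1 h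
  exact ⟨K, hK, (iterDerived_nonempty_of_lt_order h).mono (iterDerived_mono hT β)⟩

theorem le_index {K : ℝ} (hK : 1 ≤ K) (hne : ([] : List X) ∉ P K) {δ : Ordinal.{0}}
    (hδ : δ ≤ ω₁) (h : ∀ γ < δ, (iterDerived (P K) γ).Nonempty) : δ ≤ index P := by
  rcases eq_or_ne δ 0 with rfl | h0
  · exact zero_le
  have hT : IsTreeOn (P K) := by
    refine ⟨?_, hne⟩
    simpa [iterDerived_zero] using h 0 (pos_iff_ne_zero.2 h0)
  calc δ ≤ order (P K) := le_order hδ h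
    _ ≤ indexAt P K := le_csSup (bddAbove_indexAt P K) ⟨P K, hT, fun _ h => h, rfl⟩
    _ ≤ index P := le_csSup (bddAbove_index P) ⟨K, hK, rfl⟩

end Index

end BanachTree

namespace BanachTree

universe u

/-! ### Separated tails in trees of basic sequences -/

section Normed

variable {X : Type u} [NormedAddCommGroup X] [NormedSpace ℝ X]

theorem exists_sum_of_mem_seqSpan {s : List X} {x : X} (hx : x ∈ seqSpan s) :
    ∃ a : ℕ → ℝ, x = ∑ i ∈ Finset.range s.length, a i • s.getD i 0 := by
  have h : {x | x ∈ s} = Set.range s.get := by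
    ext x
    simp [List.mem_iff_get]
  rw [seqSpan, h, Submodule.mem_span_range_iff_exists_fun] at hx
  obtain ⟨c, rfl⟩ := hx
  refine ⟨fun i => if h : i < s.length then c ⟨i, h⟩ else 0, ?_⟩
  rw [Finset.sum_range]
  refine Finset.sum_congr rfl fun i _ => ?_
  simp

theorem seqSpan_mono {s t : List X} (h : s ⊆ t) : seqSpan s ≤ seqSpan t :=
  Submodule.span_mono fun _ hx => h hx

theorem IsBasicWith.norm_sum_le {K : ℝ} {s : List X} (h : IsBasicWith K s) (a : ℕ → ℝ) {k : ℕ}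
    (hk : k ≤ s.length) :
    ‖∑ i ∈ Finset.range k, a i • s.getD i 0‖ ≤
      K * ‖∑ i ∈ Finset.range s.length, a i • s.getD i 0‖ := by
  have := h (fun i => a i) k
  have h1 : ∑ i ∈ Finset.range s.length, a i • s.getD i 0 =
      ∑ i : Fin s.length, a i • s.get i := by
    rw [Finset.sum_range]
    exact Finset.sum_congr rfl fun i _ => by simp
  have h2 : ∑ i ∈ Finset.range k, a i • s.getD i 0 =
      ∑ i : Fin s.length with i.val < k, a i • s.get i := by
    rw [Finset.sum_filter]
    have : ∑ i : Fin s.length, (if i.val < k then a i • s.get i else 0) =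
        ∑ i ∈ Finset.range s.length, if i < k then a i • s.getD i 0 else 0 := by
      rw [Finset.sum_range]
      exact Finset.sum_congr rfl fun i _ => by simp
    rw [this, ← Finset.sum_filter]
    refine Finset.sum_congr ?_ fun _ _ => rfl
    ext i
    simp only [Finset.mem_range, Finset.mem_filter]
    omega
  rw [h1, h2]
  exact this

theorem IsBasicWith.norm_le_of_append {K : ℝ} {p q : List X} (h : IsBasicWith K (p ++ q))
    {y z : X} (hy : y ∈ seqSpan p) (hz : z ∈ seqSpan q) : ‖y‖ ≤ K * ‖y + z‖ := by
  obtain ⟨a, rfl⟩ := exists_sum_of_mem_seqSpan hy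
  obtain ⟨b, rfl⟩ := exists_sum_of_mem_seqSpan hz
  have := h.norm_sum_le (fun i => if i < p.length then a i else b (i - p.length))
    (k := p.length) (by simp)
  rw [List.length_append, Finset.sum_range_add] at this
  have h1 : ∑ i ∈ Finset.range p.length,
      (if i < p.length then a i else b (i - p.length)) • (p ++ q).getD i 0 =
      ∑ i ∈ Finset.range p.length, a i • p.getD i 0 := by
    refine Finset.sum_congr rfl fun i hi => ?_
    have hi := Finset.mem_range.1 hi
    rw [if_pos hi, List.getD_append _ _ _ _ hi]
  have h2 : ∑ i ∈ Finset.range q.length,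
      (if p.length + i < p.length then a (p.length + i) else b (p.length + i - p.length)) •
        (p ++ q).getD (p.length + i) 0 =
      ∑ i ∈ Finset.range q.length, b i • q.getD i 0 := by
    refine Finset.sum_congr rfl fun i hi => ?_
    rw [if_neg (by omega), List.getD_append_right _ _ _ _ (by omega), Nat.add_sub_cancel_left]
  rwa [h1, h2] at this

/-- In a tree of `K`-basic sequences, below some node the tails form a tree of large rank
whose spans stay away from finitely many given unit vectors. -/
theorem exists_tails_away {K : ℝ} (hK : 0 ≤ K) {T : Set (List X)}
    (hT : ∀ s ∈ T, IsBasicWith K s) {β : Ordinal.{0}} (J : Finset X)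
    (hJ : ∀ f ∈ J, ‖f‖ = 1) {s : List X} (hs : s ∈ iterDerived T (β * (J.card + 1 : ℕ))) :
    ∃ r, s <+: r ∧ ∀ γ < β, (iterDerived {u | u ≠ [] ∧ r ++ u ∈ T ∧
      ∀ f ∈ J, ∀ z ∈ seqSpan u, 1 / (2 * K + 1) ≤ ‖f - z‖} γ).Nonempty := by
  classical
  induction hn : J.card generalizing J s with
  | zero =>
    refine ⟨s, List.prefix_rfl, iterDerived_tail_nonempty (T := T) (s := s) (δ := 0) ?_ ?_⟩
    · intro u hu h
      rw [Finset.card_eq_zero] at hn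
      subst hn
      exact ⟨hu, iterDerived_subset _ _ h, by simp⟩
    · simpa [hn] using hs
  | succ n ih =>
    -- Either every tail of this rank avoids `J`, or some `u` comes close to an `f ∈ J`. Passing to
    -- `s ++ u` then uses up `f` at the cost of one factor `β`.
    by_cases hG : ∀ u ≠ [], s ++ u ∈ iterDerived T (β * (n + 1 : ℕ)) →
        u ∈ {u | u ≠ [] ∧ s ++ u ∈ T ∧
          ∀ f ∈ J, ∀ z ∈ seqSpan u, 1 / (2 * K + 1) ≤ ‖f - z‖}
    · refine ⟨s, List.prefix_rfl, iterDerived_tail_nonempty hG ?_⟩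
      rw [hn, Nat.cast_succ, mul_add, mul_one] at hs
      exact hs
    · push Not at hG
      obtain ⟨u, hu, hsu, hbad⟩ := hG
      have hsT := iterDerived_subset _ _ hsu
      simp only [Set.mem_ofPred_eq, not_and, not_forall, not_le] at hbad
      obtain ⟨f, hf, y, hy, hfy⟩ := hbad hu hsT
      have hcard : (J.erase f).card = n := by rw [Finset.card_erase_of_mem hf, hn]; rfl
      obtain ⟨r, ⟨w, hw⟩, hr⟩ := ih (J.erase f) (fun g hg => hJ g (Finset.mem_of_mem_erase hg))
        (by rwa [hcard]) hcard
      refine ⟨r, (List.prefix_append s u).trans ⟨w, hw⟩, fun γ hγ =>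
        (hr γ hγ).mono (iterDerived_mono ?_ γ)⟩
      rintro v ⟨hv, hvT, hvJ⟩
      refine ⟨hv, hvT, fun g hg z hz => ?_⟩
      rcases eq_or_ne g f with rfl | hne
      swap
      · exact hvJ g (Finset.mem_erase.2 ⟨hne, hg⟩) z hz
      -- If `y` before `r` ends and `z` after it are both within `1 / (2K + 1)` of `g`, then `‖y‖ >
      -- 2K / (2K + 1)` while `K‖y - z‖` is at most that.
      by_contra! hlt
      have hyr : y ∈ seqSpan r := by
        refine seqSpan_mono ?_ hy
        rw [← hw]
        intro x hx
        simp [hx]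
      have h1 := (hT _ hvT).norm_le_of_append hyr (neg_mem hz)
      have h2 : ‖y + -z‖ ≤ ‖g - y‖ + ‖g - z‖ := by
        have : y + -z = (g - z) - (g - y) := by abel
        rw [this, add_comm]
        exact norm_sub_le _ _
      have h3 : ‖g‖ ≤ ‖g - y‖ + ‖y‖ := by simpa using norm_add_le (g - y) y
      rw [hJ g hg] at h3
      have h4 : K * ‖y + -z‖ ≤ K * (2 * (1 / (2 * K + 1))) :=
        mul_le_mul_of_nonneg_left (by linarith) hK
      have h5 : (2 * K + 1) * (1 / (2 * K + 1)) = 1 := by field_simp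
      nlinarith

theorem exists_finset_net (F : Submodule ℝ X) [FiniteDimensional ℝ F] {ε : ℝ} (hε : 0 < ε) :
    ∃ J : Finset X, (∀ f ∈ J, ‖f‖ = 1) ∧ ∀ x ∈ F, ‖x‖ = 1 → ∃ f ∈ J, ‖x - f‖ < ε := by
  have hc : IsCompact ((↑) '' Metric.sphere (0 : F) 1 : Set X) :=
    (isCompact_sphere (0 : F) 1).image continuous_subtype_val
  obtain ⟨t, ht, hfin, hcov⟩ := hc.finite_cover_balls hε
  refine ⟨hfin.toFinset, ?_, ?_⟩
  · intro f hf
    obtain ⟨g, hg, rfl⟩ := ht (hfin.mem_toFinset.1 hf)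
    simpa using hg
  · intro x hx h1
    have := hcov ⟨⟨x, hx⟩, by simpa using h1, rfl⟩
    simp only [Set.mem_iUnion, Metric.mem_ball, dist_eq_norm] at this
    obtain ⟨f, hf, h⟩ := this
    exact ⟨f, hfin.mem_toFinset.2 hf, h⟩

/-- Homogeneity bounds `‖x‖` by `‖x + y‖ / δ`; the triangle inequality then bounds `‖y‖`. -/
theorem isSeparated_of_away {s u : List X} {δ : ℝ} (hδ : 0 < δ)
    (h : ∀ x ∈ seqSpan s, ‖x‖ = 1 → ∀ z ∈ seqSpan u, δ ≤ ‖x - z‖) :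
    IsSeparated (1 + 1 / δ) s u := by
  intro x hx y hy
  have h1 : ‖x‖ ≤ 1 / δ * ‖x + y‖ := by
    rcases eq_or_ne x 0 with rfl | h0
    · simp; positivity
    have hx0 : 0 < ‖x‖ := norm_pos_iff.2 h0
    have := h (‖x‖⁻¹ • x) (Submodule.smul_mem _ _ hx) (by simp [norm_smul, hx0.ne'])
      (-(‖x‖⁻¹ • y)) (neg_mem (Submodule.smul_mem _ _ hy))
    rw [sub_neg_eq_add, ← smul_add, norm_smul, norm_inv, norm_norm, inv_mul_eq_div,
      le_div_iff₀ hx0] at this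
    rw [one_div, inv_mul_eq_div, le_div_iff₀ hδ]
    linarith
  have h2 : ‖y‖ ≤ ‖x + y‖ + ‖x‖ := by
    have := norm_sub_le (x + y) x
    rwa [add_sub_cancel_left] at this
  have h3 := norm_nonneg (x + y)
  rw [add_mul, one_mul]
  exact max_le (by linarith) (by linarith)

/-- A tree of `K`-basic sequences of rank at least `β * n` for every finite `n` has a tree of
tails of rank at least `β` that is separated from a given finite sequence. -/
theorem exists_separated_tails {K : ℝ} (hK : 0 ≤ K) {T : Set (List X)}
    (hT : ∀ s ∈ T, IsBasicWith K s) {β : Ordinal.{0}}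
    (hβ : ∀ n : ℕ, (iterDerived T (β * n)).Nonempty) (s : List X) :
    ∀ γ < β, (iterDerived {u | u ≠ [] ∧ (∃ r, r ++ u ∈ T) ∧
      IsSeparated (4 * K + 3) s u} γ).Nonempty := by
  have : FiniteDimensional ℝ (seqSpan s) :=
    FiniteDimensional.span_of_finite ℝ (List.finite_toSet s)
  have hδ : 0 < 1 / (2 * K + 1) := by positivity
  -- A net of mesh half the avoided distance leaves the other half for every unit vector of the
  -- span.
  obtain ⟨J, hJ, hnet⟩ := exists_finset_net (seqSpan s) (half_pos hδ)
  obtain ⟨t, ht⟩ := hβ (J.card + 1)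
  obtain ⟨r, -, hr⟩ := exists_tails_away hK hT J hJ ht
  intro γ hγ
  refine (hr γ hγ).mono (iterDerived_mono ?_ γ)
  rintro u ⟨hu, huT, haway⟩
  refine ⟨hu, ⟨r, huT⟩, ?_⟩
  have hC : 4 * K + 3 = 1 + 1 / (1 / (2 * K + 1) / 2) := by
    field_simp
    ring
  rw [hC]
  refine isSeparated_of_away (half_pos hδ) fun x hx h1 z hz => ?_
  obtain ⟨f, hf, hxf⟩ := hnet x hx h1
  have h2 := haway f hf z hz
  have h3 : ‖f - z‖ ≤ ‖x - f‖ + ‖x - z‖ := by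
    have : f - z = (x - z) - (x - f) := by abel
    rw [this, add_comm]
    exact norm_sub_le _ _
  linarith

end Normed

end BanachTree

namespace BanachTree

universe u

/-! ### Uncountable rank and infinite branches -/

section UncountableRank

open Topology Filter

/-- Each property that fails somewhere below `ω₁` has a countable failure point, and countably many
of these have a countable supremum. -/
theorem exists_forall_of_forall_lt_omega_one {ι : Type} [Countable ι]
    {p : ι → Ordinal.{0} → Prop} (hp : ∀ i, ∀ α β, α ≤ β → p i β → p i α) :
    ∃ α < ω₁, ∀ i, p i α → ∀ β < ω₁, p i β := by
  have h : ∀ i, ∃ α < ω₁, p i α → ∀ β < ω₁, p i β := by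
    intro i
    by_cases hi : ∀ β < ω₁, p i β
    · exact ⟨0, Ordinal.omega_pos 1, fun _ => hi⟩
    · push Not at hi
      obtain ⟨β, hβ, hn⟩ := hi
      exact ⟨β, hβ, fun h => absurd h hn⟩
  choose f hf hf' using h
  have hbdd : BddAbove (Set.range f) := ⟨ω₁, by rintro _ ⟨i, rfl⟩; exact (hf i).le⟩
  exact ⟨⨆ i, f i, Ordinal.iSup_lt_omega_one hf,
    fun i hi => hf' i (hp i _ _ (le_ciSup hbdd i) hi)⟩

variable {X : Type u}

/-- The sequences whose first `n` terms form an element of `T`. -/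
def initialIn (T : Set (List X)) (n : ℕ) : Set (ℕ → X) :=
  {x | List.ofFn (fun i : Fin n => x i) ∈ T}

theorem initialIn_of_le {T : Set (List X)} (hT : ∀ s t, s <+: t → t ∈ T → s ∈ T) {m n : ℕ}
    (h : m ≤ n) {x : ℕ → X} (hx : x ∈ initialIn T n) : x ∈ initialIn T m := by
  refine hT _ _ ?_ hx
  obtain ⟨k, rfl⟩ := Nat.exists_eq_add_of_le h
  rw [List.ofFn_add]
  exact List.prefix_append _ _

/-- A prefix-closed tree of uncountable rank on a separable complete space has an infinite
branch in its closure. -/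
theorem exists_branch_closure [MetricSpace X] [CompleteSpace X]
    [TopologicalSpace.SeparableSpace X] [Nonempty X] {T : Set (List X)}
    (hT : ∀ s t, s <+: t → t ∈ T → s ∈ T) (hrank : ∀ γ < ω₁, (iterDerived T γ).Nonempty) :
    ∃ x : ℕ → X, ∀ m, (fun i : Fin m => x i) ∈ closure {v : Fin m → X | List.ofFn v ∈ T} := by
  have : SecondCountableTopology X := UniformSpace.secondCountable_of_separable X
  obtain ⟨B, hBc, -, hB⟩ := TopologicalSpace.exists_countable_basis (ℕ → X)
  obtain ⟨b, rfl⟩ := hBc.exists_eq_range (by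
    obtain ⟨U, hU, -⟩ := hB.exists_subset_of_mem_open (Set.mem_univ (fun _ => Classical.arbitrary X))
      isOpen_univ
    exact ⟨U, hU⟩)
  have hpre : ∀ γ, ∀ s t, s <+: t → t ∈ iterDerived T γ → s ∈ iterDerived T γ :=
    fun γ s t h ht => mem_iterDerived_of_prefix (hT s t h (iterDerived_subset T γ ht)) ht h
  -- A basic open set meeting the length-`n` nodes of `T^α` meets those of every countable
  -- derivative. Hence a node of `T^α` can be moved slightly into `T^(α+1)` and so extended within
  -- `T^α`.
  obtain ⟨α, hα, hstab⟩ := exists_forall_of_forall_lt_omega_one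
    (p := fun (i : ℕ × ℕ) γ => (b i.1 ∩ initialIn (iterDerived T γ) i.2).Nonempty)
    (fun i γ δ h => Set.Nonempty.mono
      (Set.inter_subset_inter_right _ fun x hx => iterDerived_antitone T h hx))
  have step : ∀ (n : ℕ) (x : ℕ → X), x ∈ initialIn (iterDerived T α) n →
      ∃ y ∈ initialIn (iterDerived T α) (n + 1), ∀ i < n, dist (x i) (y i) < (1 / 2) ^ n := by
    intro n x hx
    have hopen : IsOpen (⋂ i ∈ Finset.range n, {y : ℕ → X | dist (x i) (y i) < (1 / 2) ^ n}) :=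
      isOpen_biInter_finset fun i _ =>
        isOpen_lt (continuous_const.dist (continuous_apply i)) continuous_const
    obtain ⟨_, ⟨k, rfl⟩, hxk, hsub⟩ :=
      hB.exists_subset_of_mem_open (a := x) (by simp) hopen
    have hα1 : Order.succ α < ω₁ := (Cardinal.isSuccLimit_omega 1).succ_lt hα
    obtain ⟨y, hyk, hy⟩ := hstab (k, n) ⟨x, hxk, hx⟩ _ hα1
    have hyd := hsub hyk
    simp only [Set.mem_iInter, Finset.mem_range, Set.mem_ofPred_eq] at hyd
    have hy' : List.ofFn (fun i : Fin n => y i) ∈ iterDerived T (Order.succ α) := hy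
    obtain ⟨t, ht, ⟨r, rfl⟩, hne⟩ := ((mem_iterDerived_iff T _ _).1 hy').2 α (Order.lt_succ α)
    obtain _ | ⟨a, r⟩ := r
    · simp at hne
    refine ⟨fun i => if i < n then y i else a, ?_, fun i hi => by simpa [hi] using hyd i hi⟩
    refine hpre α _ _ ?_ ht
    rw [List.ofFn_add]
    simp
  have h0 : ∃ x, x ∈ initialIn (iterDerived T α) 0 := by
    obtain ⟨t, ht⟩ := hrank α hα
    exact ⟨fun _ => Classical.arbitrary X, hpre α _ t (by simp) ht⟩
  choose! g hg hgd using step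
  obtain ⟨x₀, hx₀⟩ := h0
  let y : ℕ → ℕ → X := fun n => Nat.rec x₀ (fun n x => g n x) n
  have hy : ∀ n, y n ∈ initialIn (iterDerived T α) n := by
    intro n
    induction n with
    | zero => exact hx₀
    | succ n ih => exact hg n _ ih
  have hyd : ∀ n, ∀ i < n, dist (y n i) (y (n + 1) i) < (1 / 2) ^ n :=
    fun n i hi => hgd n _ (hy n) i hi
  have hlim : ∀ i, ∃ z, Tendsto (fun n => y n i) atTop (𝓝 z) := by
    intro i
    -- Coordinate `i` is controlled only from stage `i + 1` on.
    have hc : CauchySeq (fun n => y (n + (i + 1)) i) := by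
      refine cauchySeq_of_le_geometric (1 / 2) 1 (by norm_num) fun n => ?_
      have h1 := hyd (n + (i + 1)) i (by omega)
      have h2 : ((1 : ℝ) / 2) ^ (n + (i + 1)) ≤ (1 / 2) ^ n :=
        pow_le_pow_of_le_one (by norm_num) (by norm_num) (by omega)
      rw [show n + 1 + (i + 1) = n + (i + 1) + 1 by ring]
      linarith
    obtain ⟨z, hz⟩ := cauchySeq_tendsto_of_complete hc
    exact ⟨z, (tendsto_add_atTop_iff_nat (i + 1)).1 hz⟩
  choose x hx using hlim
  refine ⟨x, fun m => ?_⟩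
  refine mem_closure_of_tendsto (f := fun n => fun i : Fin m => y n i) (b := atTop)
    (tendsto_pi_nhds.2 fun i => hx i) ?_
  filter_upwards [eventually_ge_atTop m] with n hn
  exact iterDerived_subset T α (initialIn_of_le (hpre α) hn (hy n))

end UncountableRank

/-! ### Gluing trees to multiply the rank -/

section Index

variable {X : Type u} {P : ℝ → Set (List X)}

theorem exists_forall_iterDerived_nonempty_of_index_eq
    (hmono : ∀ K L : ℝ, 1 ≤ K → K ≤ L → P K ⊆ P L) (h : index P = ω₁) :
    ∃ K : ℝ, 1 ≤ K ∧ ∀ γ < ω₁, (iterDerived (P K) γ).Nonempty := by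
  obtain ⟨α, hα, hK⟩ := exists_forall_of_forall_lt_omega_one
    (p := fun (n : ℕ) γ => (iterDerived (P (n + 1)) γ).Nonempty)
    (fun n γ δ h => Set.Nonempty.mono (iterDerived_antitone _ h))
  obtain ⟨K, hK1, hne⟩ := exists_iterDerived_nonempty_of_lt_index (h ▸ hα)
  refine ⟨(⌈K⌉₊ : ℝ) + 1, by linarith [Nat.cast_nonneg (α := ℝ) ⌈K⌉₊], hK ⌈K⌉₊ ?_⟩
  exact hne.mono (iterDerived_mono (hmono _ _ hK1 (by linarith [Nat.le_ceil K])) α)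

theorem omega0_le_index (hne : ∀ K : ℝ, 1 ≤ K → ([] : List X) ∉ P K)
    (hlong : ∀ n : ℕ, ∃ K : ℝ, 1 ≤ K ∧ ∃ s ∈ P K, n ≤ s.length)
    (hsegment : ∀ K : ℝ, 1 ≤ K → ∃ L : ℝ, 1 ≤ L ∧
      ∀ s ∈ P K, ∀ t : List X, t ≠ [] → t <:+: s → t ∈ P L) : ω ≤ index P := by
  rw [Ordinal.omega0_le]
  intro n
  obtain ⟨K, hK, s, hs, hn⟩ := hlong n
  obtain ⟨L, hL, hPL⟩ := hsegment K hK
  refine le_index hL (hne L hL) ((Ordinal.natCast_lt_omega0 n).le.trans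
    Ordinal.omega0_lt_omega_one.le) fun γ hγ => ?_
  obtain ⟨m, rfl⟩ := Ordinal.lt_omega0.1 (hγ.trans (Ordinal.natCast_lt_omega0 n))
  exact iterDerived_prefixes_nonempty (s := s) (fun t ht h => hPL s hs t ht h.isInfix) m
    ((Nat.cast_lt.1 hγ).trans_le hn)

variable [NormedAddCommGroup X] [NormedSpace ℝ X]

theorem exists_rank_mul_nat (hne : ∀ K : ℝ, 1 ≤ K → ([] : List X) ∉ P K)
    (hmono : ∀ K L : ℝ, 1 ≤ K → K ≤ L → P K ⊆ P L)
    (hbasic : ∀ K : ℝ, 1 ≤ K → ∀ s ∈ P K, IsBasicWith K s)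
    (hconcat : ∀ K L C : ℝ, 1 ≤ K → 1 ≤ L → 1 ≤ C → ∃ K' : ℝ, 1 ≤ K' ∧
      ∀ s ∈ P K, ∀ t ∈ P L, IsSeparated C s t → s ++ t ∈ P K')
    (hsegment : ∀ K : ℝ, 1 ≤ K → ∃ L : ℝ, 1 ≤ L ∧
      ∀ s ∈ P K, ∀ t : List X, t ≠ [] → t <:+: s → t ∈ P L)
    {α : Ordinal.{0}} (hα : α ≠ 0) {K : ℝ} (hK : 1 ≤ K)
    (hrank : ∀ γ < ω ^ α, (iterDerived (P K) γ).Nonempty) (n : ℕ) :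
    ∃ M : ℝ, 1 ≤ M ∧ ∀ γ < ω ^ α * (n + 1 : ℕ), (iterDerived (P M) γ).Nonempty := by
  have hα0 : 0 < α := pos_iff_ne_zero.2 hα
  have hpos : 0 < ω ^ α := Ordinal.opow_pos α Ordinal.omega0_pos
  obtain ⟨L, hL, hPL⟩ := hsegment K hK
  have htails : ∀ s : List X, ∀ γ < ω ^ α,
      (iterDerived {u | u ∈ P L ∧ IsSeparated (4 * K + 3) s u} γ).Nonempty := by
    intro s γ hγ
    -- With `β = γ + 1`, all finite multiples `β * n` stay below `ω ^ α`.
    have hγ1 : Order.succ γ < ω ^ α :=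
      (Ordinal.isSuccLimit_opow_left Ordinal.isSuccLimit_omega0 hα).succ_lt hγ
    refine (exists_separated_tails (zero_le_one.trans hK) (hbasic K hK) (β := Order.succ γ)
      (fun n => hrank _ (Ordinal.mul_lt_omega0_opow hα0 hγ1 (Ordinal.natCast_lt_omega0 n))) s γ
      (Order.lt_succ γ)).mono (iterDerived_mono ?_ γ)
    rintro u ⟨hu, ⟨r, hr⟩, hsep⟩
    exact ⟨hPL _ hr u hu (List.suffix_append r u).isInfix, hsep⟩
  induction n with
  | zero => exact ⟨K, hK, by simpa using hrank⟩
  | succ n ih =>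
    obtain ⟨M, hM, hn⟩ := ih
    obtain ⟨K', hK', hcat⟩ := hconcat M L (4 * K + 3) hM hL (by linarith)
    refine ⟨max M K', hM.trans (le_max_left _ _), fun γ hγ => ?_⟩
    -- The attached trees contribute the left summand, so the new copy of `ω ^ α` is split off on
    -- the left.
    have hγ' : γ < ω ^ α + ω ^ α * (n + 1 : ℕ) := by
      rw [← mul_one_add]
      convert hγ using 2
      norm_cast
      ring
    have hlt : γ - ω ^ α < ω ^ α * (n + 1 : ℕ) :=
      Ordinal.sub_lt_of_lt_add hγ' (mul_pos hpos (by exact_mod_cast n.succ_pos))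
    obtain ⟨s, hs⟩ := hn _ hlt
    refine ⟨s, iterDerived_mono ?_ γ (iterDerived_antitone _ (Ordinal.le_add_sub γ (ω ^ α))
      (mem_iterDerived_attach (δ := ω ^ α) (fun s _ => htails s)
        (fun s _ h => hne L hL h.1) _ hs))⟩
    rintro _ (ht | ⟨t, ht, u, hu, rfl⟩)
    · exact hmono _ _ hM (le_max_left _ _) ht
    · exact hmono _ _ hK' (le_max_right _ _) (hcat t ht u hu.1 hu.2)

end Index

end BanachTree

theorem theorem3p2 {X : Type*} [NormedAddCommGroup X] [NormedSpace ℝ X] [CompleteSpace X]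
    [TopologicalSpace.SeparableSpace X]
    (P : ℝ → Set (List X))
    -- each `P K` is a set of finite sequences of length at least one
    (hne : ∀ K : ℝ, 1 ≤ K → ([] : List X) ∉ P K)
    -- the property gets weaker as the constant grows
    (hmono : ∀ K L : ℝ, 1 ≤ K → K ≤ L → P K ⊆ P L)
    -- the property is satisfied by arbitrarily long finite sequences
    (hlong : ∀ n : ℕ, ∃ K : ℝ, 1 ≤ K ∧ ∃ s ∈ P K, n ≤ s.length)
    -- normalized and `K`-basic
    (hbasic : ∀ K : ℝ, 1 ≤ K → ∀ s ∈ P K,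
      BanachTree.IsNormalized s ∧ BanachTree.IsBasicWith K s)
    -- concatenation of separated sequences
    (hconcat : ∀ K L C : ℝ, 1 ≤ K → 1 ≤ L → 1 ≤ C → ∃ K' : ℝ, 1 ≤ K' ∧
      ∀ s ∈ P K, ∀ t ∈ P L, BanachTree.IsSeparated C s t → s ++ t ∈ P K')
    -- non-empty segments `(x_k, …, x_l)`
    (hsegment : ∀ K : ℝ, 1 ≤ K → ∃ L : ℝ, 1 ≤ L ∧
      ∀ s ∈ P K, ∀ t : List X, t ≠ [] → t <:+: s → t ∈ P L)
    -- closure in the product topology of `X^n`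
    (hclosure : ∀ K : ℝ, 1 ≤ K → ∃ K'' : ℝ, 1 ≤ K'' ∧ ∀ n : ℕ, 1 ≤ n →
      closure {v : Fin n → X | List.ofFn v ∈ P K} ⊆ {v : Fin n → X | List.ofFn v ∈ P K''}) :
    (BanachTree.index P = ω₁ ∧
      ∃ x : ℕ → X, (∀ i, ‖x i‖ = 1) ∧ ∃ K : ℝ, 1 ≤ K ∧
        ∀ m : ℕ, 1 ≤ m → List.ofFn (fun i : Fin m => x i) ∈ P K) ∨
    ∃ α : Ordinal.{0}, α < ω₁ ∧ BanachTree.index P = ω ^ α := by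
  rcases (BanachTree.index_le P).eq_or_lt with hω | hω
  · refine Or.inl ⟨hω, ?_⟩
    obtain ⟨K, hK, hrank⟩ :=
      BanachTree.exists_forall_iterDerived_nonempty_of_index_eq hmono hω
    obtain ⟨L, hL, hPL⟩ := hsegment K hK
    obtain ⟨M, hM, hPM⟩ := hclosure L hL
    -- `P K` need not be prefix-closed; its prefix closure is, and its non-empty members lie in `P
    -- L`.
    have hsub : P K ⊆ {s | ∃ t ∈ P K, s <+: t} := fun s hs => ⟨s, hs, List.prefix_rfl⟩
    obtain ⟨x, hx⟩ := BanachTree.exists_branch_closure (T := {s | ∃ t ∈ P K, s <+: t})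
      (by rintro s t hst ⟨r, hr, htr⟩; exact ⟨r, hr, hst.trans htr⟩)
      (fun γ hγ => (hrank γ hγ).mono (BanachTree.iterDerived_mono hsub γ))
    have hxM : ∀ m : ℕ, 1 ≤ m → List.ofFn (fun i : Fin m => x i) ∈ P M := by
      intro m hm
      refine hPM m hm (closure_mono ?_ (hx m))
      rintro v ⟨t, ht, hvt⟩
      refine hPL t ht _ ?_ hvt.isInfix
      intro h
      have := congrArg List.length h
      simp at this
      omega
    refine ⟨x, fun i => ?_, M, hM, hxM⟩
    refine (hbasic M hM _ (hxM (i + 1) (by omega))).1 (x i) ?_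
    exact List.mem_ofFn.2 ⟨Fin.last i, by simp⟩
  · refine Or.inr ?_
    have hω0 := BanachTree.omega0_le_index hne hlong hsegment
    have h0 : BanachTree.index P ≠ 0 := (Ordinal.omega0_pos.trans_le hω0).ne'
    set α := Ordinal.log ω (BanachTree.index P) with hα
    have hle : ω ^ α ≤ BanachTree.index P := Ordinal.opow_log_le_self ω h0
    refine ⟨α, (Ordinal.right_le_opow α Ordinal.one_lt_omega0).trans_lt (hle.trans_lt hω), ?_⟩
    by_contra hneq
    have hlt : ω ^ α < BanachTree.index P := lt_of_le_of_ne hle (Ne.symm hneq)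
    -- `α = 0` would make the index finite, against arbitrarily long sequences.
    have hα0 : α ≠ 0 := by
      intro h
      have := Ordinal.lt_opow_succ_log_self Ordinal.one_lt_omega0 (BanachTree.index P)
      rw [← hα, h] at this
      simp at this
      exact this.not_ge hω0
    obtain ⟨K, hK, hrank⟩ := BanachTree.exists_iterDerived_nonempty_of_lt_index hlt
    obtain ⟨n, hn⟩ := Ordinal.lt_omega0_opow_succ.1
      (Ordinal.lt_opow_succ_log_self Ordinal.one_lt_omega0 (BanachTree.index P))
    obtain ⟨M, hM, hMn⟩ := BanachTree.exists_rank_mul_nat hne hmono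
      (fun K hK s hs => (hbasic K hK s hs).2) hconcat hsegment hα0 hK
      (fun γ hγ => hrank.mono (BanachTree.iterDerived_antitone _ hγ.le)) n
    have hω1 : ω ^ α * (n + 1 : ℕ) ≤ ω₁ :=
      (Ordinal.isPrincipal_mul_omega 1 (hle.trans_lt hω)
        ((Ordinal.natCast_lt_omega0 _).trans Ordinal.omega0_lt_omega_one)).le
    have h1 := BanachTree.le_index hM (hne M hM) hω1 hMn
    have h2 : ω ^ α * (n : Ordinal.{0}) ≤ ω ^ α * (n + 1 : ℕ) := by
      gcongr
      simp
    exact (h2.trans h1).not_gt hn
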